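/- Let $f \in \mathbb{Z}[X]$ be a squarefree polynomial, that is, $f \neq 0$ and $f$ is not divisible in $\mathbb{Q}[X]$ by the square of a nonconstant polynomial. For a prime $p$ let $T_f(p)$ denote the number of integers $x$ with $1 \le x \le p-1$ and $x^{f(x)} \equiv 1 \pmod p$, where for $f(x) < 0$ the power is understood through the inverse of $x$ modulo $p$. Then $$T_f(p) \le p^{6/13 + o(1)}$$ as $p \to \infty$ over primes; that is, there is a function $\varepsilon = \varepsilon_f$ with $\varepsilon(p) \to 0$ as $p \to \infty$ such that $T_f(p) \le p^{6/13+\varepsilon(p)}$ for every prime $p$. -/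

import Mathlib

open Filter Topology Polynomial

/-- The number of integers `x` with `1 ≤ x ≤ p - 1` and `x ^ f(x) ≡ 1 (mod p)`. The exponent `f(x)`
is an integer that may be negative; since `x` is invertible modulo `p`, the power is taken as an
integer power in the field `ZMod p`. -/
def solutionCount (f : ℤ[X]) (p : ℕ) [Fact p.Prime] : ℕ :=
  ((Finset.Icc 1 (p - 1)).filter fun x : ℕ => (x : ZMod p) ^ (f.eval (x : ℤ)) = 1).card

/-!
If `x ^ f(x) = 1` modulo `p` and `t` is the order of `x`, then `t ∣ p - 1`, `x` lies in the subgroup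
`H` of order `t`, and `f(x) ≡ 0 (mod t)`. There are `p ^ o(1)` divisors `t` of `p - 1`
(`card_divisors_pow_le`), and `f`, being squarefree, has only `t ^ o(1)` roots modulo `t`
(`exists_card_rootsMod_le`: by the Chinese remainder theorem it suffices to treat prime powers, where
a Bézout relation `u f + v f' = R` bounds the valuation of `f'` at the roots). So it suffices to
bound, by a constant times `p ^ (6 / 13)`, the number `g` of `x ∈ H` in a progression
`x ≡ r (mod t)`, `1 ≤ x < p` (`card_subgroupProgression_le`).

Trivially `g ≤ t` and `g ≤ p / t + 1`, which settles all `t` outside the range between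
`p ^ (6 / 13)` and `p ^ (7 / 13)`. Inside it, the differences of the points of the progression take
only `O(p / t)` values `d`, and each nonzero `d` is the difference of at most `#(H ∩ (H - d))` pairs,
so `g ^ 2 ≤ g + O(p / t) * max_d #(H ∩ (H - d))`. The intersections are bounded by Stepanov's method
(`card_translate_le`): a nonzero combination `Ψ` of the polynomials
`X ^ a * X ^ (t * b) * (X + d) ^ (t * c)` with `a < m ^ 2` and `b, c < 2 * m` can be chosen to vanish
to order `m ^ 2` on the intersection, because on it the derivatives of `Ψ` reduce to polynomials of
low degree; comparing with `deg Ψ` gives `#(H ∩ (H - d)) = O(t / m)`. That `Ψ ≠ 0` holds because a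
polynomial with few terms cannot vanish to a high order at a nonzero point
(`eq_zero_of_X_sub_C_pow_dvd`). With `m` close to `p ^ (1 / 13)` this yields
`g ^ 2 = O(p ^ (12 / 13))`.
-/

/-! ### Linear independence of shifted powers -/

section Sparse

variable {F : Type*} [Field F]

/-- A nonzero polynomial of degree below the characteristic that vanishes at `α ≠ 0` to order `n`
has more than `n` nonzero coefficients. -/
lemma eq_zero_of_X_sub_C_pow_dvd {p : ℕ} [CharP F p] {α : F} (hα : α ≠ 0) (n : ℕ) (Q : F[X])
    (hdeg : Q.natDegree < p) (hcard : Q.support.card ≤ n) (hdvd : (X - C α) ^ n ∣ Q) : Q = 0 := by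
  induction n generalizing Q with
  | zero => simpa using hcard
  | succ n ih =>
    by_contra hQ
    -- `X Q' - e Q` with `e = deg Q` loses the leading term and only one order of vanishing.
    set e := Q.natDegree with he
    set R : F[X] := X * derivative Q - C (e : F) * Q with hR
    have hcoeff : ∀ j, R.coeff j = ((j : F) - e) * Q.coeff j := by
      intro j
      rw [hR, coeff_sub, coeff_C_mul]
      cases j with
      | zero => simp
      | succ j => rw [coeff_X_mul, coeff_derivative]; push_cast; ring
    have hsupp : R.support ⊆ Q.support.erase e := by
      intro j hj
      rw [mem_support_iff, hcoeff] at hj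
      rw [Finset.mem_erase, mem_support_iff]
      refine ⟨?_, right_ne_zero_of_mul hj⟩
      rintro rfl
      simp at hj
    have hR0 : R = 0 := by
      apply ih
      · refine lt_of_le_of_lt ?_ hdeg
        exact natDegree_le_natDegree (Finset.sup_mono (hsupp.trans (Finset.erase_subset _ _)))
      · have h1 := Finset.card_le_card hsupp
        rw [Finset.card_erase_of_mem (natDegree_mem_support_of_nonzero hQ)] at h1
        omega
      · obtain ⟨G, hG⟩ := hdvd
        refine ⟨X * ((n + 1 : F[X]) * G + (X - C α) * derivative G) - C (e : F) * (X - C α) * G, ?_⟩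
        rw [hR, hG, derivative_mul, derivative_X_sub_C_pow, Nat.add_sub_cancel, map_natCast,
          map_natCast]
        push_cast
        ring
    have hmono : Q = monomial e (Q.coeff e) := by
      ext j
      rw [coeff_monomial]
      split_ifs with h
      · rw [h]
      · by_contra hj
        have h1 := hcoeff j
        rw [hR0, coeff_zero, eq_comm, mul_eq_zero] at h1
        rcases h1 with h1 | h1
        · have hje : j ≤ e := le_natDegree_of_ne_zero hj
          rw [sub_eq_zero] at h1
          have h2 := CharP.natCast_injOn_Iio F p (Set.mem_Iio.2 (hje.trans_lt hdeg))
            (Set.mem_Iio.2 hdeg) h1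
          exact h h2.symm
        · exact hj h1
    have heval : Q.eval α = 0 := by
      obtain ⟨G, hG⟩ := hdvd
      rw [hG]; simp
    rw [hmono, eval_monomial, mul_eq_zero] at heval
    rcases heval with h | h
    · exact hQ (leadingCoeff_eq_zero.1 h)
    · exact pow_ne_zero _ hα h

/-- If `Y` divides none of the nonzero members of a family, then a vanishing combination
`∑ Q c * Y ^ c` is trivial. -/
lemma eq_zero_of_sum_mul_pow_eq_zero {R : Type*} [CommRing R] [IsDomain R] {Y : R} (hY : Y ≠ 0)
    (B : ℕ) (Q : ℕ → R) (hQ : ∀ c < B, Y ∣ Q c → Q c = 0)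
    (hsum : ∑ c ∈ Finset.range B, Q c * Y ^ c = 0) : ∀ c < B, Q c = 0 := by
  induction B generalizing Q with
  | zero => intro c hc; omega
  | succ B ih =>
    rw [Finset.sum_range_succ', pow_zero, mul_one] at hsum
    have h1 : ∑ c ∈ Finset.range B, Q (c + 1) * Y ^ (c + 1)
        = Y * ∑ c ∈ Finset.range B, Q (c + 1) * Y ^ c := by
      rw [Finset.mul_sum]
      exact Finset.sum_congr rfl fun c _ => by ring
    rw [h1] at hsum
    have h0 : Q 0 = 0 := by
      refine hQ 0 (by omega) ⟨-∑ c ∈ Finset.range B, Q (c + 1) * Y ^ c, ?_⟩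
      linear_combination hsum
    rw [h0, add_zero, mul_eq_zero, or_iff_right hY] at hsum
    intro c hc
    cases c with
    | zero => exact h0
    | succ c => exact ih (fun c => Q (c + 1)) (fun c hc => hQ (c + 1) (by omega)) hsum c (by omega)

/-- The polynomials `X ^ a * X ^ (t * b) * (X + d) ^ (t * c)` with `a < D` and `b, c < B` are
linearly independent when `B * D ≤ t` and `t * B ≤ p`: a combination of the `X ^ a * X ^ (t * b)`
is too sparse to be divisible by `(X + d) ^ t`. -/
lemma eq_zero_of_sum_mul_X_pow_mul_shift_pow {p : ℕ} [CharP F p] {d : F} (hd : d ≠ 0)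
    {t D B : ℕ} (ht : 0 < t) (hBD : B * D ≤ t) (hDt : D ≤ t) (htB : t * B ≤ p)
    (P : ℕ → ℕ → F[X]) (hP : ∀ b < B, ∀ c < B, (P b c).degree < D)
    (hsum : ∑ c ∈ Finset.range B, ∑ b ∈ Finset.range B,
      P b c * (X ^ (t * b) * (X + C d) ^ (t * c)) = 0) :
    ∀ b < B, ∀ c < B, P b c = 0 := by
  set Q : ℕ → F[X] := fun c => ∑ b ∈ Finset.range B, P b c * (X ^ t) ^ b with hQdef
  have hcoeffP : ∀ b < B, ∀ c < B, ∀ j, (P b c).coeff j ≠ 0 → j < D := fun b hb c hc j hj => by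
    by_contra h
    exact hj (coeff_eq_zero_of_degree_lt ((hP b hb c hc).trans_le (by exact_mod_cast not_lt.1 h)))
  have hQ : ∀ c < B, Q c = 0 := by
    apply eq_zero_of_sum_mul_pow_eq_zero (Y := (X + C d) ^ t)
    · exact pow_ne_zero _ (X_add_C_ne_zero d)
    · intro c hc hdvd
      have hBpos : 0 < B := by omega
      have hsub : (Q c).support ⊆
          (Finset.range B ×ˢ Finset.range D).image (fun x => x.2 + t * x.1) := by
        intro j hj
        rw [mem_support_iff, hQdef, finsetSum_coeff] at hj
        obtain ⟨b, hb, hb'⟩ := Finset.exists_ne_zero_of_sum_ne_zero hj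
        rw [← pow_mul, coeff_mul_X_pow'] at hb'
        split_ifs at hb' with hle
        · rw [Finset.mem_image]
          refine ⟨(b, j - t * b), ?_, by simp only; omega⟩
          rw [Finset.mem_product, Finset.mem_range, Finset.mem_range]
          exact ⟨Finset.mem_range.1 hb, hcoeffP b (Finset.mem_range.1 hb) c hc _ hb'⟩
        · exact absurd rfl hb'
      refine eq_zero_of_X_sub_C_pow_dvd (p := p) (α := -d) (neg_ne_zero.2 hd) t (Q c) ?_ ?_ ?_
      · have hp : 0 < p := lt_of_lt_of_le (Nat.mul_pos ht hBpos) htB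
        by_cases h0 : Q c = 0
        · simpa [h0] using hp
        have := hsub (natDegree_mem_support_of_nonzero h0)
        rw [Finset.mem_image] at this
        obtain ⟨⟨b, a⟩, hba, hj⟩ := this
        rw [Finset.mem_product, Finset.mem_range, Finset.mem_range] at hba
        rw [← hj]
        have h2 : t * (b + 1) ≤ t * B := Nat.mul_le_mul_left t hba.1
        simp only at hba ⊢
        rw [mul_add] at h2
        omega
      · calc (Q c).support.card ≤ _ := Finset.card_le_card hsub
          _ ≤ _ := Finset.card_image_le
          _ = B * D := by simp
          _ ≤ t := hBD
      · simpa using hdvd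
    · rw [← hsum]
      refine Finset.sum_congr rfl fun c _ => ?_
      rw [hQdef, Finset.sum_mul]
      exact Finset.sum_congr rfl fun b _ => by ring
  intro b hb c hc
  refine eq_zero_of_sum_mul_pow_eq_zero (Y := (X : F[X]) ^ t) (pow_ne_zero _ X_ne_zero) B
    (fun b => P b c) ?_ (hQ c hc) b hb
  intro b hb hdvd
  refine eq_zero_of_dvd_of_degree_lt hdvd ?_
  rw [degree_X_pow]
  exact (hP b hb c hc).trans_le (by exact_mod_cast hDt)

end Sparse

/-! ### Stepanov's method: translates of a subgroup -/

section Stepanov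

variable {F : Type*} [Field F]

/-- The operator on `P` induced by `X (X + d) d/dX` acting on `P * X ^ u * (X + d) ^ v`. For
`u = v = 0` it is `X (X + d) d/dX` itself. -/
noncomputable def twistedDeriv (d : F) (u v : ℕ) : Module.End F F[X] :=
  LinearMap.mulLeft F (X * (X + C d)) ∘ₗ derivative +
    LinearMap.mulLeft F (C (u : F) * (X + C d) + C (v : F) * X)

lemma twistedDeriv_apply (d : F) (u v : ℕ) (P : F[X]) :
    twistedDeriv d u v P =
      X * (X + C d) * derivative P + (C (u : F) * (X + C d) + C (v : F) * X) * P := rfl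

lemma twistedDeriv_mul (d : F) (u v : ℕ) (P : F[X]) :
    twistedDeriv d 0 0 (P * (X ^ u * (X + C d) ^ v)) =
      twistedDeriv d u v P * (X ^ u * (X + C d) ^ v) := by
  have h1 : X * derivative (X ^ u : F[X]) = C (u : F) * X ^ u := by
    cases u with
    | zero => simp
    | succ u => rw [derivative_X_pow, Nat.add_sub_cancel]; ring
  have h2 : (X + C d) * derivative ((X + C d) ^ v : F[X]) = C (v : F) * (X + C d) ^ v := by
    cases v with
    | zero => simp
    | succ v => rw [derivative_X_add_C_pow, Nat.add_sub_cancel]; simp only [map_natCast]; ring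
  rw [twistedDeriv_apply, twistedDeriv_apply, derivative_mul, derivative_mul]
  simp only [Nat.cast_zero, C_0]
  linear_combination P * (X + C d) ^ v * (X + C d) * h1 + P * X ^ u * X * h2

lemma twistedDeriv_pow_mul (d : F) (u v n : ℕ) (P : F[X]) :
    (twistedDeriv d 0 0 ^ n) (P * (X ^ u * (X + C d) ^ v)) =
      (twistedDeriv d u v ^ n) P * (X ^ u * (X + C d) ^ v) := by
  induction n with
  | zero => rfl
  | succ n ih => rw [pow_succ', pow_succ', Module.End.mul_apply, ih, twistedDeriv_mul]; rfl

lemma degree_twistedDeriv_lt (d : F) (u v : ℕ) {k : ℕ} {P : F[X]} (hP : P.degree < k) :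
    (twistedDeriv d u v P).degree < (k + 1 : ℕ) := by
  have hlin : (C (u : F) * (X + C d) + C (v : F) * X).degree ≤ 1 := by
    refine (degree_add_le _ _).trans (max_le ?_ (degree_C_mul_X_le _))
    refine (degree_mul_le _ _).trans ?_
    rw [degree_X_add_C]
    calc (C (u : F)).degree + 1 ≤ 0 + 1 := by gcongr; exact degree_C_le
      _ = 1 := zero_add _
  rw [← mem_degreeLT] at *
  by_cases h0 : P = 0
  · simp [h0]
  have hk : P.natDegree < k := by
    rw [mem_degreeLT, degree_eq_natDegree h0] at hP
    exact_mod_cast hP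
  rw [twistedDeriv_apply]
  apply Submodule.add_mem
  · rw [mem_degreeLT]
    by_cases h1 : derivative P = 0
    · rw [h1, mul_zero, degree_zero]; exact WithBot.bot_lt_coe _
    have h2 : (derivative P).natDegree < P.natDegree :=
      natDegree_derivative_lt (fun h => h1 (derivative_of_natDegree_zero h))
    refine lt_of_le_of_lt degree_le_natDegree ?_
    have h3 : (X * (X + C d) * derivative P).natDegree ≤ 1 + 1 + (derivative P).natDegree := by
      refine natDegree_mul_le.trans (Nat.add_le_add_right (natDegree_mul_le.trans ?_) _)
      rw [natDegree_X, natDegree_X_add_C]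
    exact_mod_cast (by omega : (X * (X + C d) * derivative P).natDegree < k + 1)
  · rw [mem_degreeLT]
    refine lt_of_le_of_lt degree_le_natDegree ?_
    have h3 : ((C (u : F) * (X + C d) + C (v : F) * X) * P).natDegree ≤ 1 + P.natDegree :=
      natDegree_mul_le.trans (Nat.add_le_add_right (natDegree_le_of_degree_le hlin) _)
    exact_mod_cast (by omega :
      ((C (u : F) * (X + C d) + C (v : F) * X) * P).natDegree < k + 1)

lemma degree_twistedDeriv_pow_lt (d : F) (u v : ℕ) {k : ℕ} {P : F[X]} (hP : P.degree < k)
    (n : ℕ) : ((twistedDeriv d u v ^ n) P).degree < (k + n : ℕ) := by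
  induction n with
  | zero => simpa using hP
  | succ n ih =>
    rw [pow_succ', Module.End.mul_apply, ← add_assoc]
    exact degree_twistedDeriv_lt d u v ih

lemma eval_twistedDeriv_pow_ne_zero {p : ℕ} [CharP F p] {d x : F} (hx : x ≠ 0) (hxd : x + d ≠ 0)
    {n : ℕ} (hn : n < p) (G : F[X]) (hG : G.eval x ≠ 0) :
    ((twistedDeriv d 0 0 ^ n) ((X - C x) ^ n * G)).eval x ≠ 0 := by
  induction n generalizing G with
  | zero => simpa using hG
  | succ n ih =>
    have h1 : twistedDeriv d 0 0 ((X - C x) ^ (n + 1) * G) = (X - C x) ^ n *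
        (X * (X + C d) * ((n + 1 : F[X]) * G + (X - C x) * derivative G)) := by
      rw [twistedDeriv_apply, derivative_mul, derivative_X_sub_C_pow, Nat.add_sub_cancel,
        map_natCast]
      simp only [Nat.cast_zero, C_0]
      push_cast
      ring
    rw [pow_succ, Module.End.mul_apply, h1]
    apply ih (by omega)
    have h2 : ((n : F) + 1) ≠ 0 := by
      intro h
      have h3 : ((n + 1 : ℕ) : F) = 0 := by exact_mod_cast h
      rw [CharP.cast_eq_zero_iff F p] at h3
      exact absurd (Nat.le_of_dvd (Nat.succ_pos n) h3) (by omega)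
    simp [hx, hxd, h2, hG]

/-- Vanishing of the iterates of `X (X + d) d/dX` at `x ∉ {0, -d}` detects the order of vanishing,
up to the characteristic. -/
lemma X_sub_C_pow_dvd_of_eval_twistedDeriv_pow {p : ℕ} [CharP F p] {d x : F} (hx : x ≠ 0)
    (hxd : x + d ≠ 0) {D : ℕ} (hD : D ≤ p) {Q : F[X]} (hQ : Q ≠ 0)
    (h : ∀ n < D, ((twistedDeriv d 0 0 ^ n) Q).eval x = 0) : (X - C x) ^ D ∣ Q := by
  by_contra hnd
  have hlt : Q.rootMultiplicity x < D := by
    by_contra hge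
    exact hnd ((le_rootMultiplicity_iff hQ).1 (not_lt.1 hge))
  obtain ⟨G, hG, hGx⟩ := exists_eq_pow_rootMultiplicity_mul_and_not_dvd Q hQ x
  refine eval_twistedDeriv_pow_ne_zero hx hxd (hlt.trans_le hD) G ?_ (hG ▸ h _ hlt)
  rwa [dvd_iff_isRoot] at hGx

/-- The auxiliary coefficients in Stepanov's method: there are `B ^ 2 * D` unknown coefficients and
fewer than `2 * D ^ 2` linear conditions. -/
lemma exists_stepanov_coefficients (d : F) (t : ℕ) {B D : ℕ} (hD : 0 < D)
    (hBD : 2 * D ≤ B * B) :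
    ∃ P : ℕ → ℕ → F[X], (∀ b c, (P b c).degree < D) ∧ (∃ b < B, ∃ c < B, P b c ≠ 0) ∧
      ∀ n < D, ∑ c ∈ Finset.range B, ∑ b ∈ Finset.range B,
        (twistedDeriv d (t * b) (t * c) ^ n) (P b c) = 0 := by
  let Φ : (Fin B × Fin B → degreeLT F D) →ₗ[F] (Fin D → Fin (2 * D - 1) → F) :=
    LinearMap.pi fun n => LinearMap.pi fun i => lcoeff F i ∘ₗ
      ∑ bc : Fin B × Fin B, (twistedDeriv d (t * bc.1) (t * bc.2) ^ (n : ℕ)) ∘ₗ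
        (degreeLT F D).subtype ∘ₗ LinearMap.proj bc
  have : FiniteDimensional F (degreeLT F D) :=
    (degreeLTEquiv F D).symm.finiteDimensional
  have hker : LinearMap.ker Φ ≠ ⊥ := by
    apply LinearMap.ker_ne_bot_of_finrank_lt
    simp only [Module.finrank_pi_fintype, Module.finrank_self, (degreeLTEquiv F D).finrank_eq,
      Finset.sum_const, Finset.card_univ, Fintype.card_fin, Fintype.card_prod, smul_eq_mul, mul_one]
    calc D * (2 * D - 1) < D * (2 * D) := Nat.mul_lt_mul_of_pos_left (by omega) hD
      _ ≤ B * B * D := by nlinarith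
  obtain ⟨v, hv, hv0⟩ := (Submodule.ne_bot_iff _).1 hker
  refine ⟨fun b c => if h : b < B ∧ c < B then (v (⟨b, h.1⟩, ⟨c, h.2⟩) : F[X]) else 0, ?_, ?_, ?_⟩
  · intro b c
    dsimp only
    split_ifs
    · exact mem_degreeLT.1 (v _).2
    · rw [degree_zero]; exact WithBot.bot_lt_coe _
  · obtain ⟨bc, hbc⟩ := Function.ne_iff.1 hv0
    refine ⟨bc.1, bc.1.2, bc.2, bc.2.2, ?_⟩
    simpa using hbc
  · intro n hn
    have hfin : ∑ c ∈ Finset.range B, ∑ b ∈ Finset.range B,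
        (twistedDeriv d (t * b) (t * c) ^ n)
          (if h : b < B ∧ c < B then (v (⟨b, h.1⟩, ⟨c, h.2⟩) : F[X]) else 0) =
        ∑ bc : Fin B × Fin B, (twistedDeriv d (t * bc.1) (t * bc.2) ^ n) (v bc : F[X]) := by
      rw [Fintype.sum_prod_type_right, Finset.sum_range]
      refine Finset.sum_congr rfl fun c _ => ?_
      rw [Finset.sum_range]
      refine Finset.sum_congr rfl fun b _ => ?_
      simp
    rw [hfin]
    ext i
    rw [coeff_zero]
    by_cases hi : i < 2 * D - 1
    · have h1 := congrFun (congrFun (LinearMap.mem_ker.1 hv) ⟨n, hn⟩) ⟨i, hi⟩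
      simpa [Φ] using h1
    -- Coefficients of degree at least `2 * D - 1` vanish automatically.
    · rw [finsetSum_coeff]
      refine Finset.sum_eq_zero fun bc _ => coeff_eq_zero_of_degree_lt ?_
      refine (degree_twistedDeriv_pow_lt d _ _ (mem_degreeLT.1 (v bc).2) n).trans_le ?_
      exact_mod_cast (by omega : D + n ≤ i)

/-- Stepanov's bound for the number of elements of order dividing `t` whose translate by `d ≠ 0`
also has order dividing `t`, in a form with a free parameter `m`. -/
theorem card_translate_le {p : ℕ} [CharP F p] {t m : ℕ} (hm : 0 < m) (hmt : 2 * m ^ 3 ≤ t)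
    (htp : 2 * m * t ≤ p) {d : F} (hd : d ≠ 0) (S : Finset F)
    (hS : ∀ x ∈ S, x ^ t = 1 ∧ (x + d) ^ t = 1) :
    S.card * m ^ 2 ≤ m ^ 2 + 4 * m * t := by
  have ht : 0 < t := lt_of_lt_of_le (by positivity) hmt
  have hm2 : m ^ 2 ≤ m ^ 3 := Nat.pow_le_pow_right hm (by norm_num)
  have htm : t ≤ 2 * m * t := Nat.le_mul_of_pos_left t (by omega)
  -- The choice `D = m ^ 2`, `B = 2 * m` of the number of derivatives and of the exponents.
  obtain ⟨P, hPdeg, ⟨b₀, hb₀, c₀, hc₀, hne⟩, hP⟩ :=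
    exists_stepanov_coefficients d t (B := 2 * m) (D := m ^ 2) (by positivity) (by nlinarith)
  set Ψ : F[X] := ∑ c ∈ Finset.range (2 * m), ∑ b ∈ Finset.range (2 * m),
      P b c * (X ^ (t * b) * (X + C d) ^ (t * c)) with hΨ
  have hΨ0 : Ψ ≠ 0 := fun h0 => hne <|
    eq_zero_of_sum_mul_X_pow_mul_shift_pow (p := p) hd ht (by nlinarith) (by omega) (by nlinarith) P
      (fun b _ c _ => hPdeg b c) h0 b₀ hb₀ c₀ hc₀
  -- At the points of `S` the factors `X ^ (t * b)` and `(X + d) ^ (t * c)` evaluate to `1`.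
  have hdvd : ∀ x ∈ S, (X - C x) ^ m ^ 2 ∣ Ψ := by
    intro x hx
    obtain ⟨h1, h2⟩ := hS x hx
    have hx0 : x ≠ 0 := by rintro rfl; simp [ht.ne'] at h1
    have hxd : x + d ≠ 0 := by intro h; simp [h, ht.ne'] at h2
    refine X_sub_C_pow_dvd_of_eval_twistedDeriv_pow (p := p) hx0 hxd (by omega) hΨ0 fun n hn => ?_
    have h3 := congrArg (eval x) (hP n hn)
    simp only [eval_finsetSum, eval_zero] at h3
    simp only [hΨ, map_sum, twistedDeriv_pow_mul, eval_finsetSum, eval_mul, eval_pow, eval_add,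
      eval_X, eval_C]
    simpa only [pow_mul, h1, h2, one_pow, mul_one] using h3
  have hprod : ∏ x ∈ S, (X - C x) ^ m ^ 2 ∣ Ψ := by
    refine Finset.prod_dvd_of_coprime ?_ hdvd
    intro x _ y _ hxy
    exact (isCoprime_X_sub_C_of_isUnit_sub (sub_ne_zero.2 hxy).isUnit).pow
  have hdegΨ : Ψ.natDegree ≤ m ^ 2 + 4 * m * t := by
    refine natDegree_sum_le_of_forall_le _ _ fun c hc => natDegree_sum_le_of_forall_le _ _
      fun b hb => ?_
    rw [Finset.mem_range] at hb hc
    have h1 : (P b c).natDegree ≤ m ^ 2 :=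
      natDegree_le_of_degree_le (by exact_mod_cast (hPdeg b c).le)
    have h2 : (X ^ (t * b) * (X + C d) ^ (t * c)).natDegree ≤ t * b + t * c := by
      refine natDegree_mul_le.trans ?_
      rw [natDegree_X_pow, natDegree_pow, natDegree_X_add_C, mul_one]
    refine natDegree_mul_le.trans (Nat.add_le_add h1 (h2.trans ?_))
    have h3 : t * b ≤ t * (2 * m) := Nat.mul_le_mul_left t hb.le
    have h4 : t * c ≤ t * (2 * m) := Nat.mul_le_mul_left t hc.le
    nlinarith
  have hdegprod : (∏ x ∈ S, (X - C x) ^ m ^ 2).natDegree = S.card * m ^ 2 := by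
    rw [natDegree_prod _ _ fun x _ => pow_ne_zero _ (X_sub_C_ne_zero x)]
    simp [natDegree_pow]
  rw [← hdegprod]
  exact (natDegree_le_of_dvd hprod hΨ0).trans hdegΨ

end Stepanov

/-! ### The divisor function -/

section Divisors

lemma succ_pow_le_pow_mul_two_pow (k a : ℕ) (hk : 0 < k) : (a + 1) ^ k ≤ k ^ k * 2 ^ a := by
  have h1 : a < k * (a / k + 1) := Nat.lt_mul_div_succ a hk
  have h2 : a + 1 ≤ k * 2 ^ (a / k) :=
    (Nat.succ_le_of_lt h1).trans (Nat.mul_le_mul_left k Nat.lt_two_pow_self)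
  calc (a + 1) ^ k ≤ (k * 2 ^ (a / k)) ^ k := Nat.pow_le_pow_left h2 k
    _ = k ^ k * 2 ^ (a / k * k) := by rw [mul_pow, ← pow_mul]
    _ ≤ k ^ k * 2 ^ a := Nat.mul_le_mul_left _ (Nat.pow_le_pow_right (by norm_num)
        (Nat.div_mul_le_self a k))

/-- The divisor bound `d(n) ≪ n ^ (1 / k)`. -/
lemma card_divisors_pow_le (k : ℕ) (hk : 0 < k) {n : ℕ} (hn : n ≠ 0) :
    n.divisors.card ^ k ≤ (k ^ k) ^ 2 ^ k * n := by
  have hK : 1 ≤ k ^ k := Nat.one_le_pow _ _ hk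
  have hfac : ∀ q ∈ n.primeFactors, (n.factorization q + 1) ^ k ≤
      (if q < 2 ^ k then k ^ k else 1) * q ^ n.factorization q := by
    intro q hq
    have hq2 : 2 ≤ q := (Nat.prime_of_mem_primeFactors hq).two_le
    split_ifs with h
    · exact (succ_pow_le_pow_mul_two_pow k _ hk).trans
        (Nat.mul_le_mul_left _ (Nat.pow_le_pow_left hq2 _))
    · rw [one_mul]
      calc (n.factorization q + 1) ^ k ≤ (2 ^ n.factorization q) ^ k :=
            Nat.pow_le_pow_left Nat.lt_two_pow_self k
        _ = (2 ^ k) ^ n.factorization q := by rw [← pow_mul, ← pow_mul, mul_comm]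
        _ ≤ q ^ n.factorization q := Nat.pow_le_pow_left (not_lt.1 h) _
  have hprod : ∏ q ∈ n.primeFactors, (if q < 2 ^ k then k ^ k else 1) ≤ (k ^ k) ^ 2 ^ k := by
    rw [← Finset.prod_filter, Finset.prod_const]
    refine Nat.pow_le_pow_right hK ?_
    calc (n.primeFactors.filter (· < 2 ^ k)).card ≤ (Finset.range (2 ^ k)).card :=
          Finset.card_le_card fun q hq => Finset.mem_range.2 (Finset.mem_filter.1 hq).2
      _ = 2 ^ k := Finset.card_range _
  calc n.divisors.card ^ k = ∏ q ∈ n.primeFactors, (n.factorization q + 1) ^ k := by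
        rw [Nat.card_divisors hn, Finset.prod_pow]
    _ ≤ ∏ q ∈ n.primeFactors,
          (if q < 2 ^ k then k ^ k else 1) * q ^ n.factorization q := Finset.prod_le_prod' hfac
    _ = (∏ q ∈ n.primeFactors, (if q < 2 ^ k then k ^ k else 1)) * n := by
        rw [Finset.prod_mul_distrib]
        congr 1
        exact Nat.prod_factorization_pow_eq_self hn
    _ ≤ _ := Nat.mul_le_mul_right _ hprod

end Divisors

/-! ### Roots of a squarefree polynomial modulo an integer -/

section Roots

/-- The residues `r`, represented in `[0, t)`, with `f r ≡ 0 (mod t)`. -/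
def rootsMod (f : ℤ[X]) (t : ℕ) : Finset ℕ :=
  (Finset.range t).filter fun r => (t : ℤ) ∣ f.eval (r : ℤ)

lemma mem_rootsMod {f : ℤ[X]} {t r : ℕ} :
    r ∈ rootsMod f t ↔ r < t ∧ (t : ℤ) ∣ f.eval (r : ℤ) := by
  simp [rootsMod]

lemma dvd_eval_mod {f : ℤ[X]} {t x : ℕ} (h : (t : ℤ) ∣ f.eval (x : ℤ)) :
    (t : ℤ) ∣ f.eval ((x % t : ℕ) : ℤ) := by
  have h1 := sub_dvd_eval_sub (x : ℤ) ((x % t : ℕ) : ℤ) f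
  have h2 : (t : ℤ) ∣ (x : ℤ) - ((x % t : ℕ) : ℤ) :=
    ⟨(x / t : ℕ), by have := Nat.mod_add_div x t; push_cast; zify at this; linarith⟩
  exact (dvd_sub_right h).1 (h2.trans h1)

lemma mod_mem_rootsMod {f : ℤ[X]} {t x : ℕ} (ht : 0 < t) (h : (t : ℤ) ∣ f.eval (x : ℤ)) :
    x % t ∈ rootsMod f t :=
  mem_rootsMod.2 ⟨Nat.mod_lt _ ht, dvd_eval_mod h⟩

lemma card_rootsMod_mul_le (f : ℤ[X]) {a b : ℕ} (ha : 0 < a) (hb : 0 < b) (hab : a.Coprime b) :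
    (rootsMod f (a * b)).card ≤ (rootsMod f a).card * (rootsMod f b).card := by
  rw [← Finset.card_product]
  refine Finset.card_le_card_of_injOn (fun r => (r % a, r % b)) ?_ ?_
  · intro r hr
    obtain ⟨-, hr⟩ := mem_rootsMod.1 hr
    push_cast at hr
    exact Finset.mem_coe.2 (Finset.mem_product.2
      ⟨mod_mem_rootsMod ha ((dvd_mul_right _ _).trans hr),
        mod_mem_rootsMod hb ((dvd_mul_left _ _).trans hr)⟩)
  · intro r hr s hs hrs
    rw [Prod.mk.injEq] at hrs
    exact Nat.ModEq.eq_of_lt_of_lt ((Nat.modEq_and_modEq_iff_modEq_mul hab).1 hrs)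
      (mem_rootsMod.1 hr).1 (mem_rootsMod.1 hs).1

/-- A polynomial over `ℤ` that is squarefree over `ℚ` has a Bézout relation with its derivative,
with a nonzero integer constant. -/
lemma exists_bezout_derivative {f : ℤ[X]} (hf : Squarefree (f.map (Int.castRingHom ℚ))) :
    ∃ u v : ℤ[X], ∃ R : ℤ, R ≠ 0 ∧ u * f + v * derivative f = C R := by
  obtain ⟨a, b, hab⟩ := PerfectField.separable_iff_squarefree.2 hf
  obtain ⟨r, hr, hru⟩ := IsLocalization.integerNormalization_spec (nonZeroDivisors ℤ) a
  obtain ⟨s, hs, hsv⟩ := IsLocalization.integerNormalization_spec (nonZeroDivisors ℤ) b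
  set u := IsLocalization.integerNormalization (nonZeroDivisors ℤ) a
  set v := IsLocalization.integerNormalization (nonZeroDivisors ℤ) b
  refine ⟨C s * u, C r * v, r * s,
    mul_ne_zero (nonZeroDivisors.ne_zero hr) (nonZeroDivisors.ne_zero hs), ?_⟩
  apply map_injective (Int.castRingHom ℚ) (RingHom.injective_int _)
  rw [algebraMap_int_eq] at hru hsv
  rw [Polynomial.map_add, Polynomial.map_mul, Polynomial.map_mul, Polynomial.map_mul,
    Polynomial.map_mul, hru, hsv, ← derivative_map, map_C, map_C, map_C, zsmul_eq_mul,
    zsmul_eq_mul]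
  simp only [eq_intCast, Int.cast_mul, C_mul, map_intCast]
  linear_combination (r : ℚ[X]) * (s : ℚ[X]) * hab

/-- If `q ^ k ∣ a * b` and `q ^ (r + 1) ∤ b`, then `q ^ (k - r) ∣ a`. -/
lemma pow_sub_dvd_of_pow_dvd_mul {q a b : ℤ} (hq : Prime q) {k r : ℕ} (h : q ^ k ∣ a * b)
    (hb : ¬ q ^ (r + 1) ∣ b) : q ^ (k - r) ∣ a := by
  induction r generalizing k b with
  | zero =>
    rw [zero_add, pow_one] at hb
    exact hq.pow_dvd_of_dvd_mul_right k hb h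
  | succ r ih =>
    by_cases hqb : q ∣ b
    · obtain ⟨c, rfl⟩ := hqb
      cases k with
      | zero => simp
      | succ k =>
        rw [Nat.succ_sub_succ]
        refine ih (b := c) ?_ ?_
        · rw [pow_succ'] at h
          refine (mul_dvd_mul_iff_left hq.ne_zero).1 (h.trans (dvd_of_eq (by ring)))
        · rw [pow_succ'] at hb
          exact fun hc => hb (mul_dvd_mul_left q hc)
    · exact (pow_dvd_pow q (Nat.sub_le k (r + 1))).trans (hq.pow_dvd_of_dvd_mul_right k hqb h)

/-- A quantitative form of the uniqueness in Hensel's lemma: here `q ^ (r + 1)` does not divide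
`R`, which bounds the valuation of `f'` at the roots of `f`. -/
lemma pow_sub_dvd_sub_of_roots {f u v : ℤ[X]} {R : ℤ} (huv : u * f + v * derivative f = C R)
    {q : ℤ} (hq : Prime q) {r k : ℕ} (hR : ¬ q ^ (r + 1) ∣ R) {x y : ℤ}
    (hx : q ^ k ∣ f.eval x) (hy : q ^ k ∣ f.eval y) (hxy : q ^ (r + 1) ∣ y - x) :
    q ^ (k - r) ∣ y - x := by
  by_cases hk : k ≤ r
  · simp [Nat.sub_eq_zero_of_le hk]
  obtain ⟨c, hc⟩ := f.binomExpansion x (y - x)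
  rw [add_sub_cancel] at hc
  refine pow_sub_dvd_of_pow_dvd_mul hq (b := (derivative f).eval x + c * (y - x)) ?_ ?_
  · have h1 := dvd_sub hy hx
    refine h1.trans (dvd_of_eq ?_)
    rw [hc]; ring
  · intro h
    apply hR
    have h1 : q ^ (r + 1) ∣ (derivative f).eval x :=
      (dvd_add_left (hxy.mul_left c)).1 h
    have h2 : q ^ (r + 1) ∣ f.eval x := (pow_dvd_pow q (by omega)).trans hx
    have h3 := congrArg (eval x) huv
    rw [eval_add, eval_mul, eval_mul, eval_C] at h3
    rw [← h3]
    exact dvd_add (h2.mul_left _) (h1.mul_left _)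

lemma card_rootsMod_prime_le {f u v : ℤ[X]} {R : ℤ} (huv : u * f + v * derivative f = C R)
    {q : ℕ} (hq : q.Prime) (hR : ¬ (q : ℤ) ∣ R) : (rootsMod f q).card ≤ f.natDegree := by
  have := Fact.mk hq
  set g := f.map (Int.castRingHom (ZMod q)) with hg
  have hg0 : g ≠ 0 := by
    intro h0
    have h1 := congrArg (Polynomial.map (Int.castRingHom (ZMod q))) huv
    rw [Polynomial.map_add, Polynomial.map_mul, Polynomial.map_mul, ← derivative_map, ← hg, h0,
      derivative_zero, mul_zero, mul_zero, add_zero, map_C, eq_comm, C_eq_zero, eq_intCast,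
      ZMod.intCast_zmod_eq_zero_iff_dvd] at h1
    exact hR h1
  calc (rootsMod f q).card ≤ g.roots.toFinset.card := by
        refine Finset.card_le_card_of_injOn (fun r => (r : ZMod q)) ?_ ?_
        · intro r hr
          obtain ⟨-, hr⟩ := mem_rootsMod.1 hr
          rw [Finset.mem_coe, Multiset.mem_toFinset, mem_roots hg0, IsRoot.def, hg]
          have h1 := eval_intCast_map (Int.castRingHom (ZMod q)) f (r : ℤ)
          rw [Int.cast_natCast] at h1
          rw [h1, eq_intCast, ZMod.intCast_zmod_eq_zero_iff_dvd]
          exact hr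
        · intro r hr s hs hrs
          exact Nat.ModEq.eq_of_lt_of_lt ((ZMod.natCast_eq_natCast_iff _ _ _).1 hrs)
            (mem_rootsMod.1 hr).1 (mem_rootsMod.1 hs).1
    _ ≤ Multiset.card g.roots := Multiset.toFinset_card_le _
    _ ≤ g.natDegree := card_roots' g
    _ ≤ f.natDegree := natDegree_map_le

/-- The number of roots modulo a prime power is bounded in terms of `f` alone. -/
lemma card_rootsMod_prime_pow_le {f u v : ℤ[X]} {R : ℤ} (hR0 : R ≠ 0)
    (huv : u * f + v * derivative f = C R) {q : ℕ} (hq : q.Prime) {k : ℕ} (hk : 0 < k) :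
    (rootsMod f (q ^ k)).card ≤ f.natDegree + R.natAbs ^ 3 := by
  have hqZ : Prime (q : ℤ) := Nat.prime_iff_prime_int.1 hq
  obtain ⟨R', hR', hRR'⟩ := (Int.finiteMultiplicity_iff.2
    ⟨by simpa using hq.one_lt.ne', hR0⟩ :
      FiniteMultiplicity (q : ℤ) R).exists_eq_pow_mul_and_not_dvd
  generalize multiplicity (q : ℤ) R = r at hR'
  have hRr : ¬ (q : ℤ) ^ (r + 1) ∣ R := by
    rw [hR', pow_succ, mul_dvd_mul_iff_left (pow_ne_zero _ hqZ.ne_zero)]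
    exact hRR'
  have hqr : q ^ r ≤ R.natAbs := by
    refine Nat.le_of_dvd (Int.natAbs_pos.2 hR0) ?_
    rw [← Int.natCast_dvd, hR']
    push_cast
    exact dvd_mul_right _ _
  -- Roots congruent modulo `q ^ (r + 1)` are congruent modulo `q ^ (k - r)`, so each class modulo
  -- `q ^ (r + 1)` holds at most `q ^ r` of them.
  have hfiber : (rootsMod f (q ^ k)).card ≤
      ((rootsMod f (q ^ k)).image (· % q ^ (r + 1))).card * q ^ r := by
    rw [← Finset.card_range (q ^ r), ← Finset.card_product]
    refine Finset.card_le_card_of_injOn (fun x => (x % q ^ (r + 1), x / q ^ (k - r))) ?_ ?_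
    · intro x hx
      refine Finset.mem_coe.2 (Finset.mem_product.2 ⟨Finset.mem_image_of_mem _ hx, ?_⟩)
      rw [Finset.mem_range]
      refine Nat.div_lt_of_lt_mul ((mem_rootsMod.1 hx).1.trans_le ?_)
      rw [← pow_add]
      exact Nat.pow_le_pow_right hq.pos (by omega)
    · intro x hx y hy hxy
      rw [Prod.mk.injEq] at hxy
      have hx' := (mem_rootsMod.1 hx).2
      have hy' := (mem_rootsMod.1 hy).2
      push_cast at hx' hy'
      have h1 : ((q ^ (r + 1) : ℕ) : ℤ) ∣ (y : ℤ) - x := Nat.modEq_iff_dvd.1 hxy.1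
      push_cast at h1
      have h2 := pow_sub_dvd_sub_of_roots huv hqZ hRr hx' hy' h1
      have h3 : x % q ^ (k - r) = y % q ^ (k - r) := by
        refine Nat.modEq_iff_dvd.2 ?_
        push_cast
        exact h2
      rw [← Nat.div_add_mod x (q ^ (k - r)), ← Nat.div_add_mod y (q ^ (k - r)), h3, hxy.2]
  by_cases hr : r = 0
  · subst hr
    refine hfiber.trans ?_
    rw [pow_zero, mul_one, zero_add, pow_one]
    refine le_trans (Finset.card_le_card ?_)
      ((card_rootsMod_prime_le huv hq (by simpa using hRr)).trans (Nat.le_add_right _ _))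
    intro y hy
    obtain ⟨x, hx, rfl⟩ := Finset.mem_image.1 hy
    refine mod_mem_rootsMod hq.pos (dvd_trans ?_ (mem_rootsMod.1 hx).2)
    exact_mod_cast dvd_pow_self q hk.ne'
  · calc (rootsMod f (q ^ k)).card ≤ _ := hfiber
      _ ≤ q ^ (r + 1) * q ^ r := by
        refine Nat.mul_le_mul_right _ ?_
        refine (Finset.card_le_card fun y hy => ?_).trans (Finset.card_range (q ^ (r + 1))).le
        obtain ⟨x, -, rfl⟩ := Finset.mem_image.1 hy
        exact Finset.mem_range.2 (Nat.mod_lt _ (pow_pos hq.pos _))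
      _ ≤ q ^ (r * 3) := by
        rw [← pow_add]
        exact Nat.pow_le_pow_right hq.pos (by omega)
      _ ≤ R.natAbs ^ 3 := by
        rw [pow_mul]
        exact Nat.pow_le_pow_left hqr 3
      _ ≤ _ := Nat.le_add_left _ _

/-- A polynomial squarefree over `ℚ` has at most `d(t) ^ j` roots modulo `t`. -/
lemma exists_card_rootsMod_le {f : ℤ[X]} (hf : Squarefree (f.map (Int.castRingHom ℚ))) :
    ∃ j : ℕ, ∀ t : ℕ, (rootsMod f t).card ≤ t.divisors.card ^ j := by
  obtain ⟨u, v, R, hR0, huv⟩ := exists_bezout_derivative hf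
  refine ⟨f.natDegree + R.natAbs ^ 3, fun t => ?_⟩
  induction t using Nat.recOnPosPrimePosCoprime with
  | prime_pow q k hq hk =>
    refine (card_rootsMod_prime_pow_le hR0 huv hq hk).trans (Nat.lt_two_pow_self.le.trans ?_)
    refine Nat.pow_le_pow_left ?_ _
    rw [Nat.divisors_prime_pow hq, Finset.card_map, Finset.card_range]
    omega
  | zero => simp [rootsMod]
  | one =>
    simp [rootsMod]
  | coprime a b ha hb hab iha ihb =>
    rw [hab.card_divisors_mul, mul_pow]
    exact (card_rootsMod_mul_le f (by omega) (by omega) hab).trans (Nat.mul_le_mul iha ihb)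

end Roots

/-! ### Points of a subgroup in an arithmetic progression -/

section Progression

/-- The `x ∈ [1, p - 1]` with `x ≡ r (mod t)` whose class modulo `p` lies in the subgroup of order
dividing `t`. -/
def subgroupProgression (p t r : ℕ) : Finset ℕ :=
  (Finset.Icc 1 (p - 1)).filter fun x => x % t = r ∧ (x : ZMod p) ^ t = 1

lemma mem_subgroupProgression {p t r x : ℕ} : x ∈ subgroupProgression p t r ↔
    (1 ≤ x ∧ x ≤ p - 1) ∧ x % t = r ∧ (x : ZMod p) ^ t = 1 := by
  simp [subgroupProgression]

lemma eq_of_natCast_eq {p x y : ℕ} (hx : 1 ≤ x ∧ x ≤ p - 1) (hy : 1 ≤ y ∧ y ≤ p - 1)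
    (h : (x : ZMod p) = y) : x = y :=
  Nat.ModEq.eq_of_lt_of_lt ((ZMod.natCast_eq_natCast_iff _ _ _).1 h) (by omega) (by omega)

lemma card_subgroupProgression_le_order {p t : ℕ} [Fact p.Prime] (ht : 0 < t) (r : ℕ) :
    (subgroupProgression p t r).card ≤ t := by
  calc (subgroupProgression p t r).card ≤ (nthRoots t (1 : ZMod p)).toFinset.card := by
        refine Finset.card_le_card_of_injOn (fun x => (x : ZMod p)) ?_ ?_
        · intro x hx
          rw [Finset.mem_coe, Multiset.mem_toFinset, mem_nthRoots ht]
          exact (mem_subgroupProgression.1 hx).2.2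
        · intro x hx y hy h
          exact eq_of_natCast_eq (mem_subgroupProgression.1 hx).1 (mem_subgroupProgression.1 hy).1 h
    _ ≤ Multiset.card (nthRoots t (1 : ZMod p)) := Multiset.toFinset_card_le _
    _ ≤ t := card_nthRoots t 1

lemma card_subgroupProgression_le_length (p t r : ℕ) :
    (subgroupProgression p t r).card ≤ p / t + 1 := by
  rw [← Finset.card_range (p / t + 1)]
  refine Finset.card_le_card_of_injOn (fun x => x / t) ?_ ?_
  · intro x hx
    obtain ⟨⟨-, hx⟩, -⟩ := mem_subgroupProgression.1 hx
    exact Finset.mem_coe.2 (Finset.mem_range.2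
      (Nat.lt_succ_of_le (Nat.div_le_div_right (by omega))))
  · intro x hx y hy h
    have h1 : x / t = y / t := h
    rw [← Nat.div_add_mod x t, ← Nat.div_add_mod y t, h1, (mem_subgroupProgression.1 hx).2.1,
      (mem_subgroupProgression.1 hy).2.1]

/-- Counting pairs by their difference: a bound `K` for the intersection of the subgroup with its
nontrivial translates bounds the pairs of distinct points, since all differences are `t * s` with
`|s| ≤ p / t`. -/
lemma card_subgroupProgression_mul_self_le {p t : ℕ} [Fact p.Prime] (r K : ℕ)
    (hK : ∀ d : ZMod p, d ≠ 0 → ∀ S : Finset (ZMod p),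
      (∀ x ∈ S, x ^ t = 1 ∧ (x + d) ^ t = 1) → S.card ≤ K) :
    (subgroupProgression p t r).card * (subgroupProgression p t r).card ≤
      (subgroupProgression p t r).card + K * (2 * (p / t) + 1) := by
  set A := subgroupProgression p t r with hA
  have hoff : A.offDiag.card ≤ K * (2 * (p / t) + 1) := by
    have hI : (Finset.Icc (-((p / t : ℕ) : ℤ)) ((p / t : ℕ) : ℤ)).card = 2 * (p / t) + 1 := by
      rw [Int.card_Icc]; omega
    rw [← hI]
    refine Finset.card_le_mul_card_image_of_maps_to
      (f := fun z : ℕ × ℕ => ((z.2 / t : ℕ) : ℤ) - ((z.1 / t : ℕ) : ℤ)) ?_ K ?_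
    · rintro ⟨x, y⟩ hxy
      obtain ⟨hx, hy, -⟩ := Finset.mem_offDiag.1 hxy
      have hx1 := (mem_subgroupProgression.1 hx).1
      have hy1 := (mem_subgroupProgression.1 hy).1
      have hx2 : x / t ≤ p / t := Nat.div_le_div_right (by simp only at hx1; omega)
      have hy2 : y / t ≤ p / t := Nat.div_le_div_right (by simp only at hy1; omega)
      rw [Finset.mem_Icc]
      dsimp only
      generalize x / t = a at *
      generalize y / t = b at *
      omega
    · intro s _
      have hdiff : ∀ z ∈ A.offDiag.filter
          (fun z : ℕ × ℕ => ((z.2 / t : ℕ) : ℤ) - ((z.1 / t : ℕ) : ℤ) = s),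
          z.1 ∈ A ∧ z.2 ∈ A ∧ z.1 ≠ z.2 ∧ (z.2 : ZMod p) = z.1 + ((t * s : ℤ) : ZMod p) := by
        rintro ⟨x, y⟩ hz
        obtain ⟨hxy, hs⟩ := Finset.mem_filter.1 hz
        obtain ⟨hx, hy, hne⟩ := Finset.mem_offDiag.1 hxy
        refine ⟨hx, hy, hne, ?_⟩
        have h1 : (y : ℤ) = x + t * s := by
          rw [← hs]
          have hx1 := Nat.div_add_mod x t
          have hy1 := Nat.div_add_mod y t
          rw [(mem_subgroupProgression.1 hx).2.1] at hx1
          rw [(mem_subgroupProgression.1 hy).2.1] at hy1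
          push_cast
          zify at hx1 hy1
          linear_combination hx1 - hy1
        have h2 := congrArg (Int.cast : ℤ → ZMod p) h1
        push_cast at h2 ⊢
        exact h2
      -- If the fiber over `s` is nonempty, then `t * s` is nonzero modulo `p`.
      rcases Finset.eq_empty_or_nonempty (A.offDiag.filter
          (fun z : ℕ × ℕ => ((z.2 / t : ℕ) : ℤ) - ((z.1 / t : ℕ) : ℤ) = s)) with h0 | ⟨z, hz⟩
      · rw [h0]; simp
      have hd : ((t * s : ℤ) : ZMod p) ≠ 0 := by
        obtain ⟨h1, h2, h3, h4⟩ := hdiff z hz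
        intro h0
        rw [h0, add_zero] at h4
        exact h3 (eq_of_natCast_eq (mem_subgroupProgression.1 h1).1
          (mem_subgroupProgression.1 h2).1 h4.symm)
      rw [← Finset.card_image_of_injOn (f := fun z : ℕ × ℕ => (z.1 : ZMod p))]
      · refine hK _ hd _ fun x hx => ?_
        obtain ⟨z, hz, rfl⟩ := Finset.mem_image.1 hx
        obtain ⟨h1, h2, -, h4⟩ := hdiff z hz
        refine ⟨(mem_subgroupProgression.1 h1).2.2, ?_⟩
        rw [← h4]
        exact (mem_subgroupProgression.1 h2).2.2
      · intro z hz w hw hzw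
        obtain ⟨h1, h2, -, h4⟩ := hdiff z hz
        obtain ⟨h1', h2', -, h4'⟩ := hdiff w hw
        have h5 : (z.1 : ZMod p) = w.1 := hzw
        refine Prod.ext (eq_of_natCast_eq (mem_subgroupProgression.1 h1).1
          (mem_subgroupProgression.1 h1').1 h5) (eq_of_natCast_eq (mem_subgroupProgression.1 h2).1
          (mem_subgroupProgression.1 h2').1 ?_)
        rw [h4, h4', h5]
  rw [Finset.offDiag_card] at hoff
  omega

/-- The bound for a single order `t`, in terms of `P = p ^ (1 / 13)`: counting by order when
`t ≤ P ^ 6`, by length when `t ≥ P ^ 7`, and by Stepanov's method with `m ≈ P` in between. -/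
lemma card_subgroupProgression_le {p t : ℕ} [Fact p.Prime] (ht : 0 < t) (r : ℕ) {P : ℝ}
    (hP : 2 ≤ P) (hPp : P ^ 13 = p) : ((subgroupProgression p t r).card : ℝ) ≤ 7 * P ^ 6 := by
  have hP0 : 0 < P := by linarith
  have htR : (0 : ℝ) < t := by exact_mod_cast ht
  have hP6 : 1 ≤ P ^ 6 := one_le_pow₀ (by linarith)
  have hdiv : ((p / t : ℕ) : ℝ) ≤ P ^ 13 / t := hPp ▸ Nat.cast_div_le
  rcases le_or_gt (t : ℝ) (P ^ 6) with h6 | h6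
  · have h1 : ((subgroupProgression p t r).card : ℝ) ≤ t := by
      exact_mod_cast card_subgroupProgression_le_order ht r
    linarith
  rcases le_or_gt (P ^ 7) (t : ℝ) with h7 | h7
  · have h1 : ((subgroupProgression p t r).card : ℝ) ≤ ((p / t : ℕ) : ℝ) + 1 := by
      exact_mod_cast card_subgroupProgression_le_length p t r
    have h2 : P ^ 13 / t ≤ P ^ 6 := by
      rw [div_le_iff₀ htR]
      calc P ^ 13 = P ^ 6 * P ^ 7 := by ring
        _ ≤ P ^ 6 * t := by gcongr
    linarith
  -- This choice of `m` makes `p / t` and `(p / t) * (t / m)` both `O(P ^ 12)`.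
  set m := ⌊P⌋₊ with hm
  have hmP : (m : ℝ) ≤ P := Nat.floor_le hP0.le
  have hPm : P < m + 1 := Nat.lt_floor_add_one P
  have hm0 : 0 < m := Nat.floor_pos.2 (by linarith)
  have hmR : P / 2 ≤ m := by linarith
  have hmR0 : (0 : ℝ) < m := by exact_mod_cast hm0
  have hmt : 2 * m ^ 3 ≤ t := by
    have h1 : 2 * (m : ℝ) ^ 3 ≤ t := by
      calc 2 * (m : ℝ) ^ 3 ≤ P ^ 3 * P ^ 3 := by
            gcongr
            calc (2 : ℝ) ≤ 2 ^ 3 := by norm_num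
              _ ≤ P ^ 3 := by gcongr
        _ = P ^ 6 := by ring
        _ ≤ t := h6.le
    exact_mod_cast h1
  have htp : 2 * m * t ≤ p := by
    have h1 : 2 * (m : ℝ) * t ≤ p := by
      rw [← hPp]
      calc 2 * (m : ℝ) * t ≤ P ^ 5 * P * P ^ 7 := by
            gcongr
            calc (2 : ℝ) ≤ 2 ^ 5 := by norm_num
              _ ≤ P ^ 5 := by gcongr
        _ = P ^ 13 := by ring
    exact_mod_cast h1
  set K := (m ^ 2 + 4 * m * t) / m ^ 2 with hK
  have hmain := card_subgroupProgression_mul_self_le (p := p) (t := t) r K fun d hd S hS => by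
    rw [hK, Nat.le_div_iff_mul_le (by positivity)]
    exact card_translate_le (p := p) hm0 hmt htp hd S hS
  set g := (subgroupProgression p t r).card
  have hKR : (K : ℝ) ≤ 1 + 8 * t / P := by
    calc (K : ℝ) ≤ ((m ^ 2 + 4 * m * t : ℕ) : ℝ) / ((m ^ 2 : ℕ) : ℝ) := Nat.cast_div_le
      _ = 1 + 4 * t / m := by push_cast; field_simp
      _ ≤ 1 + 4 * t / (P / 2) := by gcongr
      _ = 1 + 8 * t / P := by field_simp; ring
  have h1 : (g : ℝ) * g ≤ g + K * (2 * ((p / t : ℕ) : ℝ) + 1) := by exact_mod_cast hmain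
  have h2 : 1 ≤ P ^ 13 / t := by
    rw [one_le_div htR]
    exact h7.le.trans (pow_le_pow_right₀ (by linarith) (by norm_num))
  have h3 : (K : ℝ) * (2 * ((p / t : ℕ) : ℝ) + 1) ≤ 27 * (P ^ 6) ^ 2 := by
    calc (K : ℝ) * (2 * ((p / t : ℕ) : ℝ) + 1) ≤ (1 + 8 * t / P) * (3 * (P ^ 13 / t)) := by
          refine mul_le_mul hKR (by linarith) (by positivity) (by positivity)
      _ = 3 * (P ^ 13 / t) + 24 * P ^ 12 := by field_simp; ring
      _ ≤ 3 * (P ^ 13 / P ^ 6) + 24 * P ^ 12 := by gcongr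
      _ = 3 * P ^ 7 + 24 * P ^ 12 := by field_simp
      _ ≤ 3 * P ^ 12 + 24 * P ^ 12 := by
          gcongr
          · linarith
          · norm_num
      _ = 27 * (P ^ 6) ^ 2 := by ring
  -- `g ^ 2 ≤ g + 27 * (P ^ 6) ^ 2` fails for `g > 7 * P ^ 6`.
  by_contra! hg
  nlinarith

end Progression

/-! ### Summation over the orders -/

section Main

/-- A solution `x` of order `t` modulo `p` is a root of `f` modulo `t`. -/
lemma solutionCount_le_sum (f : ℤ[X]) (p : ℕ) [hp : Fact p.Prime] :
    solutionCount f p ≤ ∑ t ∈ (p - 1).divisors, ∑ r ∈ rootsMod f t,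
      (subgroupProgression p t r).card := by
  have hp1 : p - 1 ≠ 0 := by have := hp.out.two_le; omega
  refine le_trans (Finset.card_le_card ?_)
    (Finset.card_biUnion_le.trans (Finset.sum_le_sum fun t _ => Finset.card_biUnion_le (t := _)))
  intro x hx
  obtain ⟨hx1, hx2⟩ := Finset.mem_filter.1 hx
  rw [Finset.mem_Icc] at hx1
  have hx0 : (x : ZMod p) ≠ 0 := by
    rw [Ne, ZMod.natCast_eq_zero_iff]
    exact fun h => absurd (Nat.le_of_dvd hx1.1 h) (by omega)
  have hdvd : orderOf (x : ZMod p) ∣ p - 1 := ZMod.orderOf_dvd_card_sub_one hx0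
  have hroot : ((orderOf (x : ZMod p) : ℕ) : ℤ) ∣ f.eval (x : ℤ) := by
    have h1 : Units.mk0 (x : ZMod p) hx0 ^ f.eval (x : ℤ) = 1 := by
      ext; push_cast; exact hx2
    have h2 := orderOf_dvd_iff_zpow_eq_one.2 h1
    rwa [← orderOf_units, Units.val_mk0] at h2
  rw [Finset.mem_biUnion]
  refine ⟨_, Nat.mem_divisors.2 ⟨hdvd, hp1⟩, Finset.mem_biUnion.2 ⟨x % orderOf (x : ZMod p),
    mod_mem_rootsMod (Nat.pos_of_dvd_of_pos hdvd (by omega)) hroot,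
    mem_subgroupProgression.2 ⟨hx1, rfl, pow_orderOf_eq_one _⟩⟩⟩

lemma exists_solutionCount_le {f : ℤ[X]} (hf : Squarefree (f.map (Int.castRingHom ℚ))) :
    ∃ J : ℕ, 0 < J ∧ ∀ (p : ℕ) [Fact p.Prime], 2 ^ 13 ≤ p →
      (solutionCount f p : ℝ) ≤
        ((p - 1).divisors.card : ℝ) ^ J * (7 * (p : ℝ) ^ ((6 : ℝ) / 13)) := by
  obtain ⟨j, hj⟩ := exists_card_rootsMod_le hf
  refine ⟨j + 1, Nat.succ_pos j, fun p _ hp => ?_⟩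
  have hp1 : p - 1 ≠ 0 := by omega
  set P : ℝ := (p : ℝ) ^ ((1 : ℝ) / 13) with hPdef
  have hP13 : P ^ 13 = p := by
    rw [hPdef, ← Real.rpow_natCast, ← Real.rpow_mul (Nat.cast_nonneg p)]
    norm_num
  have hP6 : P ^ 6 = (p : ℝ) ^ ((6 : ℝ) / 13) := by
    rw [hPdef, ← Real.rpow_natCast, ← Real.rpow_mul (Nat.cast_nonneg p)]
    norm_num
  have hP2 : 2 ≤ P := by
    refine le_of_pow_le_pow_left₀ (n := 13) (by norm_num) (by positivity) ?_
    rw [hP13]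
    exact_mod_cast hp
  rw [← hP6]
  calc (solutionCount f p : ℝ)
      ≤ ∑ t ∈ (p - 1).divisors, ∑ r ∈ rootsMod f t, ((subgroupProgression p t r).card : ℝ) := by
        exact_mod_cast solutionCount_le_sum f p
    _ ≤ ∑ t ∈ (p - 1).divisors, ((p - 1).divisors.card : ℝ) ^ j * (7 * P ^ 6) := by
        refine Finset.sum_le_sum fun t ht => ?_
        have htdvd := Nat.dvd_of_mem_divisors ht
        calc ∑ r ∈ rootsMod f t, ((subgroupProgression p t r).card : ℝ)
            ≤ ∑ r ∈ rootsMod f t, 7 * P ^ 6 := Finset.sum_le_sum fun r _ =>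
              card_subgroupProgression_le (Nat.pos_of_mem_divisors ht) r hP2 hP13
          _ = ((rootsMod f t).card : ℝ) * (7 * P ^ 6) := by rw [Finset.sum_const, nsmul_eq_mul]
          _ ≤ ((p - 1).divisors.card : ℝ) ^ j * (7 * P ^ 6) := by
            gcongr
            have h1 : (rootsMod f t).card ≤ (p - 1).divisors.card ^ j :=
              (hj t).trans (Nat.pow_le_pow_left
                (Finset.card_le_card (Nat.divisors_subset_of_dvd hp1 htdvd)) j)
            exact_mod_cast h1
    _ = ((p - 1).divisors.card : ℝ) ^ (j + 1) * (7 * P ^ 6) := by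
        rw [Finset.sum_const, nsmul_eq_mul, pow_succ']
        ring

lemma eventually_solutionCount_le {f : ℤ[X]} (hf : Squarefree (f.map (Int.castRingHom ℚ)))
    {η : ℝ} (hη : 0 < η) : ∀ᶠ p : ℕ in atTop, ∀ _ : Fact p.Prime,
      (solutionCount f p : ℝ) ≤ (p : ℝ) ^ ((6 : ℝ) / 13 + η) := by
  obtain ⟨J, hJ, hT⟩ := exists_solutionCount_le hf
  obtain ⟨l, hl⟩ := exists_nat_one_div_lt hη
  set k := J * (l + 1) with hk
  have hk0 : 0 < k := Nat.mul_pos hJ (Nat.succ_pos l)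
  set δ : ℝ := 1 / ((l : ℝ) + 1) with hδ
  set M : ℝ := (((k ^ k) ^ 2 ^ k : ℕ) : ℝ) with hM
  have hlim : Tendsto (fun p : ℕ => (p : ℝ) ^ (η - δ)) atTop atTop :=
    (tendsto_rpow_atTop (by linarith)).comp tendsto_natCast_atTop_atTop
  filter_upwards [eventually_ge_atTop (2 ^ 13), hlim.eventually_ge_atTop (7 * M ^ δ)]
    with p hp hpM hprime
  have hp0 : (0 : ℝ) < p := by
    have : 0 < p := by omega
    exact_mod_cast this
  have hdiv : ((p - 1).divisors.card : ℝ) ^ J ≤ M ^ δ * (p : ℝ) ^ δ := by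
    have h1 : (((p - 1).divisors.card : ℝ) ^ J) ^ (l + 1) ≤ M * p := by
      rw [← pow_mul, hM]
      have h2 : (p - 1).divisors.card ^ k ≤ (k ^ k) ^ 2 ^ k * p :=
        (card_divisors_pow_le k hk0 (by omega)).trans (Nat.mul_le_mul_left _ (Nat.sub_le p 1))
      exact_mod_cast h2
    rw [← Real.mul_rpow (Nat.cast_nonneg _) hp0.le]
    calc ((p - 1).divisors.card : ℝ) ^ J
        = ((((p - 1).divisors.card : ℝ) ^ J) ^ (l + 1)) ^ δ := by
          rw [← Real.rpow_natCast _ (l + 1), ← Real.rpow_mul (by positivity), hδ]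
          push_cast
          rw [mul_one_div_cancel (by positivity), Real.rpow_one]
      _ ≤ (M * p) ^ δ := Real.rpow_le_rpow (by positivity) h1 (by positivity)
  calc (solutionCount f p : ℝ)
      ≤ ((p - 1).divisors.card : ℝ) ^ J * (7 * (p : ℝ) ^ ((6 : ℝ) / 13)) := hT p hp
    _ ≤ M ^ δ * (p : ℝ) ^ δ * (7 * (p : ℝ) ^ ((6 : ℝ) / 13)) := by gcongr
    _ = 7 * M ^ δ * (p : ℝ) ^ δ * (p : ℝ) ^ ((6 : ℝ) / 13) := by ring
    _ ≤ (p : ℝ) ^ (η - δ) * (p : ℝ) ^ δ * (p : ℝ) ^ ((6 : ℝ) / 13) := by gcongr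
    _ = (p : ℝ) ^ ((6 : ℝ) / 13 + η) := by
      rw [← Real.rpow_add hp0, ← Real.rpow_add hp0]
      congr 1
      ring

end Main

theorem theorem2 (f : ℤ[X]) (hf : Squarefree (f.map (Int.castRingHom ℚ))) :
    ∃ ε : ℕ → ℝ, Tendsto ε atTop (𝓝 0) ∧
      ∀ (p : ℕ) [Fact p.Prime],
        (solutionCount f p : ℝ) ≤ (p : ℝ) ^ ((6 : ℝ) / 13 + ε p) := by
  -- The positive part of the excess of the true exponent over `6 / 13`.
  refine ⟨fun p => if h : p.Prime then
    max 0 (Real.logb p (@solutionCount f p ⟨h⟩) - 6 / 13) else 0, ?_, ?_⟩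
  · rw [Metric.tendsto_atTop']
    intro η hη
    obtain ⟨N, hN⟩ := eventually_atTop.1 (eventually_solutionCount_le hf (half_pos hη))
    refine ⟨N, fun p hp => ?_⟩
    rw [Real.dist_eq, sub_zero]
    split_ifs with h
    · rw [abs_of_nonneg (le_max_left _ _)]
      refine (max_le (half_pos hη).le ?_).trans_lt (half_lt_self hη)
      have hp1 : (1 : ℝ) < p := by exact_mod_cast h.one_lt
      rcases Nat.eq_zero_or_pos (@solutionCount f p ⟨h⟩) with h0 | h0
      · rw [h0, Nat.cast_zero, Real.logb_zero]
        linarith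
      · have h1 := (Real.logb_le_iff_le_rpow hp1 (by exact_mod_cast h0)).2 (hN p hp.le ⟨h⟩)
        linarith
    · simpa using hη
  · intro p hp
    have hp1 : (1 : ℝ) < p := by exact_mod_cast hp.out.one_lt
    beta_reduce
    rw [dif_pos hp.out]
    rcases Nat.eq_zero_or_pos (solutionCount f p) with h0 | h0
    · rw [h0, Nat.cast_zero]
      positivity
    · refine (Real.logb_le_iff_le_rpow hp1 (by exact_mod_cast h0)).1 ?_
      linarith [le_max_right 0 (Real.logb p (solutionCount f p) - 6 / 13)]
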